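/- **Setting.** There are $K$ arms $\mathcal A=\{1,\dots,K\}$ and a budget $n$. Let $m=\lceil\log_2 K\rceil$ and $n_s=\lfloor n/m\rfloor$. The rewards $Y_{s,t,i}$ (arm $i$, round $t$ of stage $s$) are independent with $Y_{s,t,i}\sim\mathcal N(\mu_i,\sigma_i^2)$, where $\sigma_{\max}=\max_{i\in\mathcal A}\sigma_i>0$. **Algorithm (SHAdaVar with confidence parameter $\delta\in(0,1)$).** Let $\mathcal A_1=\mathcal A$. In each stage $s=1,\dots,m$, one arm $I_{s,t}\in\mathcal A_s$ is pulled in each round $t=1,\dots,n_s$, and its reward $Y_{s,t,I_{s,t}}$ is observed. Let $N_{s,t,i}$, $\hat\mu_{s,t,i}$ and $\hat\sigma^2_{s,t,i}$ be the number of pulls, the empirical mean and the unbiased empirical variance of arm $i$ in rounds $1,\dots,t-1$ of stage $s$, and let $$U_{s,t,i}=\frac{\hat\sigma_{s,t,i}^2}{1-2\sqrt{\frac{\log(1/\delta)}{N_{s,t,i}-1}}}.$$ Let $L$ be the least integer larger than $4\log(1/\delta)+1$. For $t\le|\mathcal A_s|L$, the arms in $\mathcal A_s$ are pulled in round-robin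 order; for $t>|\mathcal A_s|L$, $I_{s,t}\in\arg\max_{i\in\mathcal A_s}U_{s,t,i}/N_{s,t,i}$. After stage $s$, let $N_{s,i}$ be the number of pulls of arm $i$ in stage $s$; $\mathcal A_{s+1}$ consists of $\lceil|\mathcal A_s|/2\rceil$ arms of $\mathcal A_s$ with the highest empirical means of the rewards observed in stage $s$. Ties are broken by any fixed deterministic rule, which may depend on the stage, the round and the set of tied options. **Claim.** With probability at least $1-Kn\delta$, simultaneously for all stages $s\in\{1,\dots,m\}$ with $n_s>2|\mathcal A_s|$ and all arms $i\in\mathcal A_s$, $$N_{s,i}\ \ge\ \frac{\sigma_i^2}{\sigma_{\max}^2}\,\alpha(|\mathcal A_s|,n_s,\delta)\left(\frac{n_s}{|\mathcal A_s|}-1\right),$$ where $$\alpha(k,n,\delta)=\frac{1-2\sqrt{\frac{\log(1/\delta)}{n/k-2}}}{1+2\sqrt{\frac{\log(1/\delta)}{n/k-2}}+\frac{2\log(1/\delta)}{n/k-2}}.$$ (Equivalently, for $\delta\in(0,1)$, when the algorithm is run with $\delta/(Kn)$ in place of $\delta$, the bounds with $\alpha(|\mathcal A_s|,n_s,\delta/(Kn))$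 hold simultaneously with probability at least $1-\delta$.) -/

import Mathlib

open MeasureTheory ProbabilityTheory
open scoped NNReal

noncomputable section

namespace SHAdaVar

/-- What the agent has observed so far in the current stage: the list of pairs
(pulled arm, observed reward), oldest first. A history of length `t` is the information
available before the `(t + 1)`-st round of the stage. -/
abbrev History (K : ℕ) := List (Fin K × ℝ)

variable {K : ℕ}

/-- The observed rewards of arm `i`, oldest first. -/
def rewards (h : History K) (i : Fin K) : List ℝ :=
  (h.filter (fun p => p.1 = i)).map Prod.snd

/-- The number of pulls of arm `i`. -/
def numPulls (h : History K) (i : Fin K) : ℕ := (rewards h i).length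

/-- The empirical mean reward of arm `i` (with value `0` if the arm has not been pulled). -/
def empMean (h : History K) (i : Fin K) : ℝ := (rewards h i).sum / (numPulls h i : ℝ)

/-- The unbiased empirical variance of the rewards of arm `i`. -/
def empVar (h : History K) (i : Fin K) : ℝ :=
  ((rewards h i).map (fun y => (y - empMean h i) ^ 2)).sum / ((numPulls h i : ℝ) - 1)

/-- The upper confidence bound on the reward variance of arm `i`. It is used by the algorithm
only when `numPulls h i > 4 log (1 / δ) + 1`, so that the denominator is positive. -/
def varUCB (δ : ℝ) (h : History K) (i : Fin K) : ℝ :=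
  empVar h i / (1 - 2 * √(Real.log (1 / δ) / ((numPulls h i : ℝ) - 1)))

/-- The number of initial pulls of each arm in a stage: the least natural number that is
larger than `4 log (1 / δ) + 1`. -/
def initPulls (δ : ℝ) : ℕ := ⌊4 * Real.log (1 / δ) + 1⌋₊ + 1

open Classical in
/-- The arms that may be pulled in the next round of a stage with the set of remaining arms `A`:
in the initial rounds the next arm of `A` in the round-robin order (a single arm), later the
maximizers over `A` of the variance upper confidence bound divided by the number of pulls. -/
def candidates (δ : ℝ) (A : Finset (Fin K)) (h : History K) : Finset (Fin K) :=
  if h.length < A.card * initPulls δ then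
    A.filter (fun i => (A.filter (fun j => j < i)).card = h.length % A.card)
  else
    A.filter (fun i => ∀ j ∈ A,
      varUCB δ h j / (numPulls h j : ℝ) ≤ varUCB δ h i / (numPulls h i : ℝ))

open Classical in
/-- The sets of `⌈|A| / 2⌉` arms of `A` with the highest empirical means. There is
more than one such set only if there are ties. -/
def topHalves (A : Finset (Fin K)) (h : History K) : Finset (Finset (Fin K)) :=
  (A.powersetCard ((A.card + 1) / 2)).filter
    (fun B => ∀ i ∈ B, ∀ j ∈ A, j ∉ B → empMean h j ≤ empMean h i)

/-- A rule that breaks ties, both in the choice of the pulled arm (in stage `s` and round `t`)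
and in the choice of the arms that survive stage `s`. -/
structure TieBreak (K : ℕ) where
  arm : ℕ → ℕ → Finset (Fin K) → Fin K
  arm_mem : ∀ s t C, C.Nonempty → arm s t C ∈ C
  half : ℕ → Finset (Finset (Fin K)) → Finset (Fin K)
  half_mem : ∀ s D, D.Nonempty → half s D ∈ D

/-- The history of stage `s` after `t` rounds, when the remaining arms are `A` and
`y t i` is the reward of arm `i` in round `t`. Stages and rounds are numbered from `0`. -/
def stageHistory (τ : TieBreak K) (δ : ℝ) (s : ℕ) (A : Finset (Fin K)) (y : ℕ → Fin K → ℝ) :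
    ℕ → History K
  | 0 => []
  | t + 1 =>
    let h := stageHistory τ δ s A y t
    let i := τ.arm s t (candidates δ A h)
    h ++ [(i, y t i)]

/-- The number of stages, `⌈log₂ K⌉`. -/
def numStages (K : ℕ) : ℕ := Nat.clog 2 K

/-- The per-stage budget, `⌊n / ⌈log₂ K⌉⌋`. -/
def stageBudget (K n : ℕ) : ℕ := n / numStages K

/-- The set of remaining arms at the beginning of stage `s`, where `y s t i` is the
reward of arm `i` in round `t` of stage `s`. -/
def activeArms (τ : TieBreak K) (δ : ℝ) (n : ℕ) (y : ℕ → ℕ → Fin K → ℝ) :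
    ℕ → Finset (Fin K)
  | 0 => Finset.univ
  | s + 1 =>
    let A := activeArms τ δ n y s
    τ.half s (topHalves A (stageHistory τ δ s A (y s) (stageBudget K n)))

/-- The number of pulls of arm `i` in the whole stage `s`. -/
def stagePulls (τ : TieBreak K) (δ : ℝ) (n : ℕ) (y : ℕ → ℕ → Fin K → ℝ) (s : ℕ)
    (i : Fin K) : ℕ :=
  numPulls (stageHistory τ δ s (activeArms τ δ n y s) (y s) (stageBudget K n)) i

/-- The factor `α(k, n, δ)`. -/
def alpha (k n δ : ℝ) : ℝ :=
  (1 - 2 * √(Real.log (1 / δ) / (n / k - 2))) /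
    (1 + 2 * √(Real.log (1 / δ) / (n / k - 2)) + 2 * Real.log (1 / δ) / (n / k - 2))

/-- The maximum reward standard deviation over all arms. -/
def sigmaMax (σ : Fin K → ℝ≥0) : ℝ≥0 := Finset.univ.sup σ

end SHAdaVar

end

/-!
Why the bound holds. Suppose that in a stage with `k` remaining arms and `T` rounds the empirical
variances obey their confidence bounds. Some arm `j` is pulled at least `T / k` times. Unless the
claim is trivial, this exceeds the share of the round-robin phase, so the last pull of `j` happens
in an adaptive round, and there the index (variance bound divided by number of pulls) of `j` is
the largest. The index of any other arm `i` is at least `σ i ^ 2` divided by its number of pulls,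
and that of `j` is at most `σ j ^ 2 / alpha` divided by its number of pulls, which is at least
`T / k - 1`. Comparing the two gives the claim (`numPulls_lower_bound`). The lower confidence
bound is used only for arms with fewer than `T / k - 1` pulls (otherwise the claim is trivial) and
the upper one only for at least `T / k - 1` pulls. As `k` does not depend on the rewards
(`card_activeArms`), one one-sided event for each stage, arm and number of pulls suffices, which
makes at most `K * n` events, each of probability at most `δ`.

The probability of such an event is bounded although the rounds in which arm `i` is pulled are
random. For a standard Gaussian sample of size `N`, the conditional expectation of
`exp (l * ∑ (zᵢ - z̄) ^ 2)` given the first `r` elements is an explicit function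
`samplePotential` of `r`, of their sum and of their sum of squares
(`lintegral_samplePotential_sampleStep`). The decision to pull `i` depends only on earlier rewards
(`measurableSet_pulledArm_eq`), of which the next reward is independent, so this potential of the
rewards of `i` observed so far does not increase in mean (`lintegral_predictable_selection_le`).
Markov's inequality with a suitable `l` yields the chi-squared tail bounds of Laurent and Massart
with `N - 1` degrees of freedom (`measure_varianceFailure_le`).
-/

/-! ### An exponential martingale for the sample variance -/

namespace SHAdaVar

/-- The exponential moment of a quadratic function under the standard Gaussian law, by completing
the square. -/
lemma lintegral_exp_quadratic_gaussianReal (a B c : ℝ) (ha : 0 < a) :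
    ∫⁻ z, ENNReal.ofReal (Real.exp (c + B * z - (a - 1) * z ^ 2 / 2)) ∂(gaussianReal 0 1)
      = ENNReal.ofReal (Real.exp (c + B ^ 2 / (2 * a)) / √a) := by
  have hv : a⁻¹.toNNReal ≠ 0 := (Real.toNNReal_pos.2 (inv_pos.2 ha)).ne'
  rw [gaussianReal_of_var_ne_zero 0 one_ne_zero,
    lintegral_withDensity_eq_lintegral_mul _ (measurable_gaussianPDF 0 1) (by fun_prop)]
  calc _ = ∫⁻ z, ENNReal.ofReal (Real.exp (c + B ^ 2 / (2 * a)) / √a) *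
        gaussianPDF (B / a) a⁻¹.toNNReal z := by
        refine lintegral_congr fun z => ?_
        simp only [Pi.mul_apply, gaussianPDF, gaussianPDFReal]
        rw [← ENNReal.ofReal_mul (by positivity), ← ENNReal.ofReal_mul (by positivity)]
        congr 1
        simp only [NNReal.coe_one, mul_one, Real.coe_toNNReal _ (inv_pos.2 ha).le]
        rw [Real.sqrt_mul (by positivity) a⁻¹, Real.sqrt_inv]
        have hs : √a ≠ 0 := by positivity
        have e : c + B * z - (a - 1) * z ^ 2 / 2 + -(z - 0) ^ 2 / 2
            = c + B ^ 2 / (2 * a) + -(z - B / a) ^ 2 / (2 * a⁻¹) := by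
          field_simp
          ring
        rw [mul_assoc, ← Real.exp_add, add_comm (-(z - 0) ^ 2 / 2), e, Real.exp_add]
        field_simp
    _ = _ := by
        rw [lintegral_const_mul _ (by fun_prop), lintegral_gaussianPDF_eq_one _ hv, mul_one]

/-- One sampling step on the statistics `(r, p, q)` of a sample: its size, its sum and its sum of
squares. Samples are not extended beyond size `N`. -/
noncomputable def sampleStep (N : ℕ) (x : ℕ × ℝ × ℝ) (z : ℝ) : ℕ × ℝ × ℝ :=
  if x.1 < N then (x.1 + 1, x.2.1 + z, x.2.2 + z ^ 2) else x

/-- The conditional expectation of `exp (l * ∑ (zᵢ - z̄) ^ 2)` for a standard Gaussian sample of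
size `N`, given that the statistics of its first `r` elements are `(r, p, q)`. -/
noncomputable def samplePotential (N : ℕ) (l : ℝ) (x : ℕ × ℝ × ℝ) : ℝ :=
  √(N * (1 - 2 * l) / (N - 2 * l * x.1)) / √(1 - 2 * l) ^ (N - x.1)
    * Real.exp (l * x.2.2 - l * (1 - 2 * l) / (N - 2 * l * x.1) * x.2.1 ^ 2)

lemma measurable_sampleStep (N : ℕ) : Measurable (Function.uncurry (sampleStep N)) := by
  unfold sampleStep Function.uncurry
  refine Measurable.ite (measurableSet_lt (by fun_prop) measurable_const) ?_ (by fun_prop)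
  refine Measurable.prodMk ?_ (by fun_prop)
  exact (measurable_of_countable (fun n : ℕ => n + 1)).comp (by fun_prop)

lemma measurable_samplePotential (N : ℕ) (l : ℝ) : Measurable (samplePotential N l) := by
  have h : Measurable fun x : ℕ × ℝ × ℝ => (x.1 : ℝ) :=
    (measurable_of_countable (fun n : ℕ => (n : ℝ))).comp measurable_fst
  have h' : Measurable fun x : ℕ × ℝ × ℝ => √(1 - 2 * l) ^ (N - x.1) :=
    (measurable_of_countable (fun n : ℕ => √(1 - 2 * l) ^ (N - n))).comp measurable_fst
  unfold samplePotential
  fun_prop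

/-- The martingale property of `samplePotential` under sampling from the standard Gaussian law,
by `lintegral_exp_quadratic_gaussianReal` with
`a = (1 - 2 * l) * (N - 2 * l * r) / (N - 2 * l * (r + 1))`. -/
lemma lintegral_samplePotential_sampleStep (N : ℕ) (l : ℝ) (hl : l < 1 / 2) (x : ℕ × ℝ × ℝ) :
    ∫⁻ z, ENNReal.ofReal (samplePotential N l (sampleStep N x z)) ∂(gaussianReal 0 1)
      = ENNReal.ofReal (samplePotential N l x) := by
  obtain ⟨r, p, q⟩ := x
  by_cases hr : r < N
  · have hw : 0 < 1 - 2 * l := by linarith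
    have hrN : (r : ℝ) + 1 ≤ N := by exact_mod_cast hr
    have hr0 : (0 : ℝ) ≤ r := r.cast_nonneg
    have hD : 0 < (N : ℝ) - 2 * l * r := by nlinarith
    have hD' : 0 < (N : ℝ) - 2 * l * (r + 1) := by nlinarith
    have hN : (0 : ℝ) < N := by linarith
    obtain ⟨k, hk⟩ : ∃ k, N - r = k + 1 := ⟨N - r - 1, by omega⟩
    have hk' : N - (r + 1) = k := by omega
    set w := 1 - 2 * l with hwdef
    set D := (N : ℝ) - 2 * l * r with hDdef
    set D' := (N : ℝ) - 2 * l * (r + 1) with hD'def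
    have hDD : D = D' + 2 * l := by rw [hDdef, hD'def]; ring
    have ha : 0 < w * D / D' := by positivity
    have key := lintegral_exp_quadratic_gaussianReal (w * D / D') (-(2 * l * w / D') * p)
      (l * q - l * w / D' * p ^ 2) ha
    set C := √(N * w / D') / √w ^ k with hC
    have hC0 : 0 ≤ C := by positivity
    calc _ = ∫⁻ z, ENNReal.ofReal C * ENNReal.ofReal (Real.exp (l * q - l * w / D' * p ^ 2
            + -(2 * l * w / D') * p * z - (w * D / D' - 1) * z ^ 2 / 2)) ∂(gaussianReal 0 1) := by
          refine lintegral_congr fun z => ?_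
          rw [← ENNReal.ofReal_mul hC0]
          simp only [sampleStep, samplePotential, if_pos hr, hk', Nat.cast_add, Nat.cast_one,
            ← hwdef, ← hD'def]
          rw [← hC]
          congr 3
          have : w * D / D' - 1 = 2 * l * w / D' - 2 * l := by
            rw [hDD, hwdef]; field_simp; ring
          rw [this]
          ring
      _ = _ := by
          rw [lintegral_const_mul _ (by fun_prop), key, ← ENNReal.ofReal_mul hC0]
          simp only [samplePotential, hk, ← hwdef, ← hDdef, hC]
          congr 1
          have e1 : l * q - l * w / D' * p ^ 2 + (-(2 * l * w / D') * p) ^ 2 / (2 * (w * D / D'))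
              = l * q - l * w / D * p ^ 2 := by
            have : l * w / D = l * w / D' - 2 * l ^ 2 * w / (D * D') := by
              field_simp; rw [hDD]; ring
            rw [this]
            field_simp
            ring
          rw [e1]
          have e2 : √(N * w / D') = √(N * w / D) * √(D / D') := by
            rw [← Real.sqrt_mul (by positivity)]; congr 1; field_simp
          have e3 : √(w * D / D') = √w * √(D / D') := by
            rw [← Real.sqrt_mul hw.le]; congr 1; ring
          have h1 : √w ≠ 0 := by positivity
          have h2 : √(D / D') ≠ 0 := by positivity
          rw [e2, e3]
          field_simp
          ring
  · simp [sampleStep, hr]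

lemma samplePotential_full (N : ℕ) (hN : 0 < N) (l : ℝ) (hl : l < 1 / 2) (p q : ℝ) :
    samplePotential N l (N, p, q) = Real.exp (l * (q - p ^ 2 / N)) := by
  have hN' : (0 : ℝ) < N := by exact_mod_cast hN
  have hw : 0 < 1 - 2 * l := by linarith
  have e : (N : ℝ) - 2 * l * N = N * (1 - 2 * l) := by ring
  simp only [samplePotential, e, Nat.sub_self, pow_zero, div_one]
  rw [div_self (by positivity), Real.sqrt_one, one_mul]
  rw [mul_div_mul_right _ _ hw.ne']
  congr 1
  ring

/-- The exponential moment of the chi-squared law with `N - 1` degrees of freedom. -/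
lemma samplePotential_empty (N : ℕ) (hN : 0 < N) (l : ℝ) (hl : l < 1 / 2) :
    samplePotential N l (0, 0, 0)
      = Real.exp (-((N : ℝ) - 1) / 2 * Real.log (1 - 2 * l)) := by
  have hN' : (0 : ℝ) < N := by exact_mod_cast hN
  have hw : 0 < 1 - 2 * l := by linarith
  have hs : 0 < √(1 - 2 * l) := by positivity
  obtain ⟨k, rfl⟩ : ∃ k, N = k + 1 := ⟨N - 1, by omega⟩
  have e : Real.exp (-(((k + 1 : ℕ) : ℝ) - 1) / 2 * Real.log (1 - 2 * l))
      = (√(1 - 2 * l) ^ k)⁻¹ := by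
    rw [← Real.exp_log (show 0 < (√(1 - 2 * l) ^ k)⁻¹ by positivity), Real.log_inv, Real.log_pow,
      Real.log_sqrt hw.le]
    congr 1
    push_cast
    ring
  rw [e]
  simp only [samplePotential, Nat.cast_zero, mul_zero, sub_zero, Nat.sub_zero]
  rw [mul_div_cancel_left₀ _ hN'.ne']
  simp only [pow_succ]
  field_simp
  simp

/-- The Chernoff exponent of the upper tail of the chi-squared law with `d` degrees of freedom, at
`l = u / (1 + 2 * u)`. -/
lemma chernoff_upper (d u : ℝ) (hd : 0 ≤ d) (hu : 0 ≤ u) :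
    -d / 2 * Real.log (1 - 2 * (u / (1 + 2 * u)))
      ≤ u / (1 + 2 * u) * (d * (1 + 2 * u + 2 * u ^ 2)) - d * u ^ 2 := by
  have hv : 0 < 1 + 2 * u := by positivity
  have e : 1 - 2 * (u / (1 + 2 * u)) = (1 + 2 * u)⁻¹ := by field_simp; ring
  have h : Real.log (1 + 2 * u) ≤ ((1 + 2 * u) - (1 + 2 * u)⁻¹) / 2 := by
    rw [← Real.sinh_log hv]
    exact Real.self_le_sinh_iff.2 (Real.log_nonneg (by linarith))
  rw [e, Real.log_inv]
  have e2 : u / (1 + 2 * u) * (d * (1 + 2 * u + 2 * u ^ 2)) - d * u ^ 2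
      = d / 2 * (((1 + 2 * u) - (1 + 2 * u)⁻¹) / 2) := by
    field_simp
    ring
  rw [e2]
  have := mul_le_mul_of_nonneg_left h (by linarith : 0 ≤ d / 2)
  linarith

/-- The Chernoff exponent of the lower tail of the chi-squared law with `d` degrees of freedom, at
`l = -u`. -/
lemma chernoff_lower (d u : ℝ) (hd : 0 ≤ d) (hu : 0 ≤ u) :
    -d / 2 * Real.log (1 - 2 * (-u)) ≤ -u * (d * (1 - 2 * u)) - d * u ^ 2 := by
  have h := Real.le_log_one_add_of_nonneg (show 0 ≤ 2 * u by positivity)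
  have h2 : 2 * u - 2 * u ^ 2 ≤ 2 * (2 * u) / (2 * u + 2) := by
    rw [le_div_iff₀ (by positivity)]
    nlinarith [pow_nonneg hu 3]
  have e : 1 - 2 * (-u) = 1 + 2 * u := by ring
  rw [e]
  nlinarith [mul_le_mul_of_nonneg_left (h2.trans h) hd]

end SHAdaVar

/-! ### Predictable selection from independent samples -/

namespace SHAdaVar

/-- If the state `x t` is updated with a fresh sample `Z t` exactly when the event `D t`, which is
decided before `Z t` is drawn, occurs, then a potential that does not increase in mean under an
update with law `ν` does not increase in mean along `x`. -/
theorem lintegral_predictable_selection_le {Ω E : Type*} {m0 : MeasurableSpace Ω}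
    (P : Measure Ω) [IsProbabilityMeasure P] [MeasurableSpace E]
    (ν : Measure ℝ) [IsProbabilityMeasure ν]
    (F : ℕ → MeasurableSpace Ω) (hF : ∀ t, F t ≤ m0) (hmono : Monotone F)
    (Z : ℕ → Ω → ℝ) (hZ : ∀ t, Measurable (Z t)) (hZF : ∀ t, Measurable[F (t + 1)] (Z t))
    (hlaw : ∀ t, P.map (Z t) = ν)
    (hind : ∀ t, Indep (F t) (MeasurableSpace.comap (Z t) inferInstance) P)
    (D : ℕ → Set Ω) (hD : ∀ t, MeasurableSet[F t] (D t))
    (step : E → ℝ → E) (hstep : Measurable (Function.uncurry step))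
    (V : E → ENNReal) (hV : Measurable V) (hVstep : ∀ e, ∫⁻ z, V (step e z) ∂ν ≤ V e)
    (x : ℕ → Ω → E) (e₀ : E) (hx0 : ∀ ω, x 0 ω = e₀)
    (hstepD : ∀ t, ∀ ω ∈ D t, x (t + 1) ω = step (x t ω) (Z t ω))
    (hstepD' : ∀ t, ∀ ω ∉ D t, x (t + 1) ω = x t ω) (t : ℕ) :
    Measurable (x t) ∧ ∫⁻ ω, V (x t ω) ∂P ≤ V e₀ := by
  classical
  have hrec : ∀ t, x (t + 1) = fun ω => if ω ∈ D t then step (x t ω) (Z t ω) else x t ω := by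
    intro t
    funext ω
    split_ifs with h
    · exact hstepD t ω h
    · exact hstepD' t ω h
  have hx : ∀ t, Measurable[F t] (x t) := by
    intro t
    induction t with
    | zero =>
      rw [show x 0 = fun _ => e₀ from funext hx0]
      exact measurable_const
    | succ t ih =>
      rw [hrec]
      have h1 : Measurable[F (t + 1)] (x t) := ih.mono (hmono t.le_succ) le_rfl
      refine Measurable.ite (hmono t.le_succ _ (hD t)) ?_ h1
      exact hstep.comp (h1.prodMk (hZF t))
  refine ⟨(hx t).mono (hF t) le_rfl, ?_⟩
  induction t with
  | zero => simp [hx0]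
  | succ t ih =>
    refine le_trans ?_ ih
    -- The pair `X` of the state and the selection decision is independent of the sample.
    let X : Ω → E × Prop := fun ω => (x t ω, ω ∈ D t)
    let G : (E × Prop) × ℝ → ENNReal := fun y => if y.1.2 then V (step y.1.1 y.2) else V y.1.1
    have hXF : Measurable[F t] X :=
      (hx t).prodMk (@MeasurableSet.mem Ω (D t) (F t) (hD t))
    have hX : Measurable X := hXF.mono (hF t) le_rfl
    have hG : Measurable G := by
      refine Measurable.ite ?_ ?_ (hV.comp (measurable_fst.comp measurable_fst))
      · exact measurableSet_setOfPred.2 (measurable_snd.comp measurable_fst)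
      · exact hV.comp (hstep.comp ((measurable_fst.comp measurable_fst).prodMk measurable_snd))
    have hXZ : IndepFun X (Z t) P := by
      rw [IndepFun_iff_Indep]
      exact indep_of_indep_of_le_left (hind t) hXF.comap_le
    have hmap : P.map (fun ω => (X ω, Z t ω)) = (P.map X).prod ν := by
      rw [← hlaw t]
      exact (indepFun_iff_map_prod_eq_prod_map_map hX.aemeasurable (hZ t).aemeasurable).1 hXZ
    have : IsProbabilityMeasure (P.map X) := Measure.isProbabilityMeasure_map hX.aemeasurable
    calc ∫⁻ ω, V (x (t + 1) ω) ∂P = ∫⁻ ω, G (X ω, Z t ω) ∂P := by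
          refine lintegral_congr fun ω => ?_
          rw [hrec]
          simp only [G, X]
          split_ifs <;> rfl
      _ = ∫⁻ y, G y ∂(P.map fun ω => (X ω, Z t ω)) :=
          (lintegral_map hG (hX.prodMk (hZ t))).symm
      _ = ∫⁻ y, ∫⁻ z, G (y, z) ∂ν ∂(P.map X) := by
          rw [hmap, lintegral_prod _ hG.aemeasurable]
      _ = ∫⁻ ω, ∫⁻ z, G (X ω, z) ∂ν ∂P := lintegral_map hG.lintegral_prod_right' hX
      _ ≤ ∫⁻ ω, V (x t ω) ∂P := by
          refine lintegral_mono fun ω => ?_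
          by_cases h : ω ∈ D t
          · simpa [G, X, h] using hVstep (x t ω)
          · simp [G, X, h]

/-! ### Chi-squared tail bounds -/

section Tails

variable {Ω : Type*} [MeasurableSpace Ω] {P : Measure Ω} {N : ℕ} {x : Ω → ℕ × ℝ × ℝ}

/-- Markov's inequality for `samplePotential`. -/
lemma measure_sampleDeviation_le (hN : 0 < N) (hx : Measurable x) {l : ℝ} (hl : l < 1 / 2)
    (h : ∫⁻ ω, ENNReal.ofReal (samplePotential N l (x ω)) ∂P
      ≤ ENNReal.ofReal (samplePotential N l (0, 0, 0))) (a : ℝ) :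
    P {ω | (x ω).1 = N ∧ l * a ≤ l * ((x ω).2.2 - (x ω).2.1 ^ 2 / N)}
      ≤ ENNReal.ofReal (Real.exp (-((N : ℝ) - 1) / 2 * Real.log (1 - 2 * l) - l * a)) := by
  have hm : Measurable fun ω => ENNReal.ofReal (samplePotential N l (x ω)) :=
    ENNReal.measurable_ofReal.comp ((measurable_samplePotential N l).comp hx)
  have h1 := (mul_meas_ge_le_lintegral (μ := P) hm (ENNReal.ofReal (Real.exp (l * a)))).trans h
  rw [samplePotential_empty N hN l hl] at h1
  have hsub : {ω | (x ω).1 = N ∧ l * a ≤ l * ((x ω).2.2 - (x ω).2.1 ^ 2 / N)}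
      ⊆ {ω | ENNReal.ofReal (Real.exp (l * a)) ≤ ENNReal.ofReal (samplePotential N l (x ω))} := by
    rintro ω ⟨hω, hle⟩
    have : x ω = (N, (x ω).2.1, (x ω).2.2) := by rw [← hω]
    refine ENNReal.ofReal_le_ofReal ?_
    rw [this, samplePotential_full N hN l hl]
    exact Real.exp_le_exp.2 hle
  refine (measure_mono hsub).trans ?_
  have hpos : ENNReal.ofReal (Real.exp (l * a)) ≠ 0 := by
    simpa using Real.exp_pos _
  rw [Real.exp_sub, ENNReal.ofReal_div_of_pos (Real.exp_pos _),
    ENNReal.le_div_iff_mul_le (Or.inl hpos) (Or.inl ENNReal.ofReal_ne_top), mul_comm]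
  exact h1

lemma measure_sampleDeviation_upper_le (hN : 0 < N) (hx : Measurable x)
    (h : ∀ l < 1 / 2, ∫⁻ ω, ENNReal.ofReal (samplePotential N l (x ω)) ∂P
      ≤ ENNReal.ofReal (samplePotential N l (0, 0, 0))) {u : ℝ} (hu : 0 ≤ u) :
    P {ω | (x ω).1 = N ∧ ((N : ℝ) - 1) * (1 + 2 * u + 2 * u ^ 2)
        < (x ω).2.2 - (x ω).2.1 ^ 2 / N}
      ≤ ENNReal.ofReal (Real.exp (-(((N : ℝ) - 1) * u ^ 2))) := by
  have hN1 : (1 : ℝ) ≤ N := by exact_mod_cast hN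
  have hl : u / (1 + 2 * u) < 1 / 2 := by
    rw [div_lt_div_iff₀ (by positivity) (by norm_num)]
    linarith
  refine (measure_mono ?_).trans ((measure_sampleDeviation_le hN hx hl (h _ hl)
    (((N : ℝ) - 1) * (1 + 2 * u + 2 * u ^ 2))).trans ?_)
  · rintro ω ⟨h1, h2⟩
    exact ⟨h1, mul_le_mul_of_nonneg_left h2.le (by positivity)⟩
  · refine ENNReal.ofReal_le_ofReal (Real.exp_le_exp.2 ?_)
    linarith [chernoff_upper ((N : ℝ) - 1) u (by linarith) hu]

lemma measure_sampleDeviation_lower_le (hN : 0 < N) (hx : Measurable x)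
    (h : ∀ l < 1 / 2, ∫⁻ ω, ENNReal.ofReal (samplePotential N l (x ω)) ∂P
      ≤ ENNReal.ofReal (samplePotential N l (0, 0, 0))) {u : ℝ} (hu : 0 ≤ u) :
    P {ω | (x ω).1 = N ∧ (x ω).2.2 - (x ω).2.1 ^ 2 / N < ((N : ℝ) - 1) * (1 - 2 * u)}
      ≤ ENNReal.ofReal (Real.exp (-(((N : ℝ) - 1) * u ^ 2))) := by
  have hN1 : (1 : ℝ) ≤ N := by exact_mod_cast hN
  have hl : -u < 1 / 2 := by linarith
  refine (measure_mono ?_).trans ((measure_sampleDeviation_le hN hx hl (h _ hl)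
    (((N : ℝ) - 1) * (1 - 2 * u))).trans ?_)
  · rintro ω ⟨h1, h2⟩
    exact ⟨h1, mul_le_mul_of_nonpos_left h2.le (by linarith)⟩
  · refine ENNReal.ofReal_le_ofReal (Real.exp_le_exp.2 ?_)
    linarith [chernoff_lower ((N : ℝ) - 1) u (by linarith) hu]

end Tails

end SHAdaVar

/-! ### Measurability of the run -/

namespace SHAdaVar

variable {K : ℕ}

lemma rewards_append_singleton (h : History K) (i j : Fin K) (y : ℝ) :
    rewards (h ++ [(i, y)]) j = if i = j then rewards h j ++ [y] else rewards h j := by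
  unfold rewards
  split_ifs with hij <;> simp [hij]

/-- The arm pulled in round `t` of stage `s`. -/
noncomputable def pulledArm (τ : TieBreak K) (δ : ℝ) (s : ℕ) (A : Finset (Fin K))
    (y : ℕ → Fin K → ℝ) (t : ℕ) : Fin K :=
  τ.arm s t (candidates δ A (stageHistory τ δ s A y t))

section Step

variable (τ : TieBreak K) (δ : ℝ) (s : ℕ) (A : Finset (Fin K)) (y : ℕ → Fin K → ℝ)

lemma rewards_stageHistory_succ (t : ℕ) (j : Fin K) :
    rewards (stageHistory τ δ s A y (t + 1)) j
      = if pulledArm τ δ s A y t = j then rewards (stageHistory τ δ s A y t) j ++ [y t j]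
        else rewards (stageHistory τ δ s A y t) j := by
  have : stageHistory τ δ s A y (t + 1) = stageHistory τ δ s A y t
      ++ [(pulledArm τ δ s A y t, y t (pulledArm τ δ s A y t))] := rfl
  rw [this, rewards_append_singleton]
  split_ifs with h
  · rw [h]
  · rfl

lemma length_stageHistory (t : ℕ) : (stageHistory τ δ s A y t).length = t := by
  induction t with
  | zero => rfl
  | succ t ih =>
    have : stageHistory τ δ s A y (t + 1) = stageHistory τ δ s A y t
      ++ [(pulledArm τ δ s A y t, y t (pulledArm τ δ s A y t))] := rfl
    rw [this, List.length_append, ih]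
    rfl

end Step

lemma sum_sq_sub_mean (l : List ℝ) (m c : ℝ) (hc : c ≠ 0) :
    (l.map fun y => (y - l.sum / l.length) ^ 2).sum
      = c ^ 2 * ((l.map fun y => ((y - m) / c) ^ 2).sum
          - ((l.map fun y => (y - m) / c).sum) ^ 2 / l.length) := by
  have h1 : ∀ (l : List ℝ) (a : ℝ), (l.map fun y => (y - a) ^ 2).sum
      = (l.map fun y => y ^ 2).sum - 2 * a * l.sum + l.length * a ^ 2 := by
    intro l a
    induction l with
    | nil => simp
    | cons b l ih =>
      simp only [List.map_cons, List.sum_cons, ih, List.length_cons]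
      push_cast
      ring
  have h2 : (l.map fun y => ((y - m) / c) ^ 2).sum = (l.map fun y => (y - m) ^ 2).sum / c ^ 2 := by
    induction l with
    | nil => simp
    | cons b l ih => simp only [List.map_cons, List.sum_cons, ih]; field_simp
  have h3 : (l.map fun y => (y - m) / c).sum = (l.sum - l.length * m) / c := by
    clear h2
    induction l with
    | nil => simp
    | cons b l ih =>
      simp only [List.map_cons, List.sum_cons, ih, List.length_cons]
      push_cast
      ring
  rw [h1, h2, h3, h1]
  rcases l.eq_nil_or_concat with rfl | ⟨l', b, rfl⟩
  · simp
  · have : ((l' ++ [b]).length : ℝ) ≠ 0 := by simp; positivity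
    field_simp
    ring

lemma empVar_eq (h : History K) (i : Fin K) (m c : ℝ) (hc : c ≠ 0) :
    empVar h i = c ^ 2 * (((rewards h i).map fun y => ((y - m) / c) ^ 2).sum
          - (((rewards h i).map fun y => (y - m) / c).sum) ^ 2 / (numPulls h i : ℝ))
        / ((numPulls h i : ℝ) - 1) := by
  rw [empVar, empMean, numPulls, sum_sq_sub_mean _ m c hc]

section Measurability

variable {Ω : Type*} [MeasurableSpace Ω]

lemma measurableSet_of_countable_index {α : Type*} [Countable α] (f : Ω → α) (g : α → Ω → Prop)
    (hf : ∀ a, MeasurableSet {ω | f ω = a}) (hg : ∀ a, MeasurableSet {ω | g a ω}) :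
    MeasurableSet {ω | g (f ω) ω} := by
  have : {ω | g (f ω) ω} = ⋃ a, {ω | f ω = a} ∩ {ω | g a ω} := by
    ext ω
    simp
  rw [this]
  exact MeasurableSet.iUnion fun a => (hf a).inter (hg a)

/-- The statistics of the history that the algorithm uses are measurable. -/
def MeasurableStats (h : Ω → History K) : Prop :=
  ∀ i, Measurable (fun ω => (rewards (h ω) i).length) ∧
    Measurable (fun ω => (rewards (h ω) i).sum) ∧
    Measurable (fun ω => ((rewards (h ω) i).map fun y => y ^ 2).sum)

lemma MeasurableStats.empMean {h : Ω → History K} (hh : MeasurableStats h) (i : Fin K) :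
    Measurable fun ω => SHAdaVar.empMean (h ω) i := by
  have h1 : Measurable fun ω => ((rewards (h ω) i).length : ℝ) :=
    (measurable_of_countable (fun n : ℕ => (n : ℝ))).comp (hh i).1
  exact (hh i).2.1.div h1

lemma MeasurableStats.varUCB {h : Ω → History K} (hh : MeasurableStats h) (δ : ℝ) (i : Fin K) :
    Measurable fun ω => SHAdaVar.varUCB δ (h ω) i / (numPulls (h ω) i : ℝ) := by
  have h1 : Measurable fun ω => (numPulls (h ω) i : ℝ) :=
    (measurable_of_countable (fun n : ℕ => (n : ℝ))).comp (hh i).1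
  have h2 := (hh i).2.1
  have h3 := (hh i).2.2
  unfold SHAdaVar.varUCB
  simp only [empVar_eq _ _ 0 1 one_ne_zero, sub_zero, div_one]
  simp only [List.map_id']
  fun_prop

lemma MeasurableStats.candidates {h : Ω → History K} (hh : MeasurableStats h) (δ : ℝ)
    (A C : Finset (Fin K)) (t : ℕ) (ht : ∀ ω, (h ω).length = t) :
    MeasurableSet {ω | SHAdaVar.candidates δ A (h ω) = C} := by
  unfold SHAdaVar.candidates
  simp only [ht]
  split_ifs with hlt
  · exact MeasurableSet.const _
  · simp only [Finset.ext_iff, Finset.mem_filter]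
    refine measurableSet_setOfPred.2 (Measurable.forall fun i => ?_)
    refine Measurable.iff (Measurable.and measurable_const ?_) measurable_const
    refine Measurable.forall fun j => Measurable.imp measurable_const ?_
    exact measurableSet_setOfPred.1 (measurableSet_le (hh.varUCB δ j) (hh.varUCB δ i))

lemma MeasurableStats.topHalves {h : Ω → History K} (hh : MeasurableStats h)
    (A : Finset (Fin K)) (C : Finset (Finset (Fin K))) :
    MeasurableSet {ω | SHAdaVar.topHalves A (h ω) = C} := by
  unfold SHAdaVar.topHalves
  simp only [Finset.ext_iff (s₁ := Finset.filter _ _), Finset.mem_filter]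
  refine measurableSet_setOfPred.2 (Measurable.forall fun B => ?_)
  refine Measurable.iff (Measurable.and measurable_const ?_) measurable_const
  refine Measurable.forall fun i => Measurable.imp measurable_const ?_
  refine Measurable.forall fun j => Measurable.imp measurable_const (Measurable.imp
    measurable_const ?_)
  exact measurableSet_setOfPred.1 (measurableSet_le (hh.empMean j) (hh.empMean i))

variable (τ : TieBreak K) (δ : ℝ)

lemma MeasurableStats.arm {h : Ω → History K} (hh : MeasurableStats h) (s : ℕ)
    (A : Finset (Fin K)) (t : ℕ) (ht : ∀ ω, (h ω).length = t) (i : Fin K) :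
    MeasurableSet {ω | τ.arm s t (SHAdaVar.candidates δ A (h ω)) = i} :=
  measurableSet_of_countable_index (fun ω => SHAdaVar.candidates δ A (h ω))
    (fun C _ => τ.arm s t C = i) (fun C => hh.candidates δ A C t ht) fun _ => MeasurableSet.const _

lemma measurableStats_stageHistory (s : ℕ) (A : Finset (Fin K)) (y : Ω → ℕ → Fin K → ℝ) (t : ℕ)
    (hy : ∀ u < t, ∀ i, Measurable fun ω => y ω u i) :
    MeasurableStats fun ω => stageHistory τ δ s A (y ω) t := by
  induction t with
  | zero => intro i; simp [stageHistory, rewards]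
  | succ t ih =>
    have ih := ih fun u hu => hy u (hu.trans t.lt_succ_self)
    intro i
    have hD := ih.arm τ δ s A t (fun ω => length_stageHistory τ δ s A (y ω) t) i
    have hyt := hy t t.lt_succ_self i
    obtain ⟨h1, h2, h3⟩ := ih i
    simp only [rewards_stageHistory_succ]
    refine ⟨?_, ?_, ?_⟩
    · simp only [apply_ite List.length, List.length_append, List.length_singleton]
      exact Measurable.ite hD ((measurable_of_countable (fun n : ℕ => n + 1)).comp h1) h1
    · simp only [apply_ite List.sum, List.sum_append, List.sum_singleton]
      exact Measurable.ite hD (h2.add hyt) h2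
    · simp only [apply_ite (List.map _), apply_ite List.sum, List.map_append, List.sum_append,
        List.map_singleton, List.sum_singleton]
      exact Measurable.ite hD (h3.add (hyt.pow_const 2)) h3

lemma measurableSet_activeArms_eq (n s : ℕ) (y : Ω → ℕ → ℕ → Fin K → ℝ)
    (hy : ∀ r < s, ∀ u i, Measurable fun ω => y ω r u i) (A : Finset (Fin K)) :
    MeasurableSet {ω | activeArms τ δ n (y ω) s = A} := by
  induction s generalizing A with
  | zero => simp [activeArms]
  | succ s ih =>
    have ih := ih fun r hr => hy r (hr.trans s.lt_succ_self)
    refine measurableSet_of_countable_index (fun ω => activeArms τ δ n (y ω) s)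
      (fun B ω => τ.half s (topHalves B
        (stageHistory τ δ s B (y ω s) (stageBudget K n))) = A) ih fun B => ?_
    exact measurableSet_of_countable_index
      (fun ω => topHalves B (stageHistory τ δ s B (y ω s) (stageBudget K n)))
      (fun C _ => τ.half s C = A)
      (fun C => (measurableStats_stageHistory τ δ s B (fun ω => y ω s) _
        fun u _ i => hy s s.lt_succ_self u i).topHalves B C) fun _ => MeasurableSet.const _

/-- The decision to pull an arm is determined by the rewards of the earlier stages and rounds. -/
lemma measurableSet_pulledArm_eq (n s t : ℕ) (y : Ω → ℕ → ℕ → Fin K → ℝ)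
    (hy : ∀ r < s, ∀ u i, Measurable fun ω => y ω r u i)
    (hy' : ∀ u < t, ∀ i, Measurable fun ω => y ω s u i) (i : Fin K) :
    MeasurableSet {ω | pulledArm τ δ s (activeArms τ δ n (y ω) s) (y ω s) t = i} :=
  measurableSet_of_countable_index (fun ω => activeArms τ δ n (y ω) s)
    (fun A ω => pulledArm τ δ s A (y ω s) t = i) (measurableSet_activeArms_eq τ δ n s y hy)
    fun A => (measurableStats_stageHistory τ δ s A (fun ω => y ω s) t hy').arm τ δ s A t
      (fun ω => length_stageHistory τ δ s A (y ω s) t) i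

end Measurability

end SHAdaVar

/-! ### Combinatorics of a stage -/

namespace SHAdaVar

variable {K : ℕ}

/-- Greedily adding a maximizer of `f` yields the sets of largest values of each size. -/
lemma exists_top_subset {α : Type*} [DecidableEq α] (A : Finset α) (f : α → ℝ) (r : ℕ)
    (hr : r ≤ A.card) :
    ∃ B ⊆ A, B.card = r ∧ ∀ i ∈ B, ∀ j ∈ A, j ∉ B → f j ≤ f i := by
  induction r with
  | zero => exact ⟨∅, by simp, by simp, by simp⟩
  | succ r ih =>
    obtain ⟨B, hBA, hB, hf⟩ := ih (by omega)
    have hne : (A \ B).Nonempty := by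
      rw [← Finset.card_pos, Finset.card_sdiff_of_subset hBA]
      omega
    obtain ⟨i₀, hi₀, hmax⟩ := Finset.exists_max_image (A \ B) f hne
    rw [Finset.mem_sdiff] at hi₀
    refine ⟨insert i₀ B, Finset.insert_subset hi₀.1 hBA, ?_, ?_⟩
    · rw [Finset.card_insert_of_notMem hi₀.2, hB]
    · intro i hi j hj hjn
      simp only [Finset.mem_insert, not_or] at hi hjn
      rcases hi with rfl | hi
      · exact hmax j (Finset.mem_sdiff.2 ⟨hj, hjn.2⟩)
      · exact hf i hi j hj hjn.2

lemma topHalves_nonempty (A : Finset (Fin K)) (h : History K) : (topHalves A h).Nonempty := by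
  obtain ⟨B, hBA, hB, hf⟩ := exists_top_subset A (empMean h) ((A.card + 1) / 2) (by omega)
  exact ⟨B, Finset.mem_filter.2 ⟨Finset.mem_powersetCard.2 ⟨hBA, hB⟩, hf⟩⟩

/-- The number of remaining arms at the beginning of stage `s`, which does not depend on the
rewards. -/
def activeCount (K : ℕ) : ℕ → ℕ
  | 0 => K
  | s + 1 => (activeCount K s + 1) / 2

lemma card_activeArms (τ : TieBreak K) (δ : ℝ) (n : ℕ) (y : ℕ → ℕ → Fin K → ℝ) (s : ℕ) :
    (activeArms τ δ n y s).card = activeCount K s := by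
  induction s with
  | zero => simp [activeArms, activeCount]
  | succ s ih =>
    rw [activeArms, activeCount, ← ih]
    have := τ.half_mem s _ (topHalves_nonempty (activeArms τ δ n y s)
      (stageHistory τ δ s (activeArms τ δ n y s) (y s) (stageBudget K n)))
    rw [topHalves, Finset.mem_filter] at this
    exact (Finset.mem_powersetCard.1 this.1).2

/-- The position of `i` in the increasing enumeration of `A`. -/
def rank (A : Finset (Fin K)) (i : Fin K) : ℕ := (A.filter fun j => j < i).card

lemma rank_strictMonoOn (A : Finset (Fin K)) : StrictMonoOn (rank A) A := by
  intro i hi j hj hij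
  refine Finset.card_lt_card ⟨?_, ?_⟩
  · intro l hl
    rw [Finset.mem_filter] at hl ⊢
    exact ⟨hl.1, hl.2.trans hij⟩
  · intro hsub
    have := hsub (Finset.mem_filter.2 ⟨hi, hij⟩)
    simp at this

lemma rank_lt_card {A : Finset (Fin K)} {i : Fin K} (hi : i ∈ A) : rank A i < A.card := by
  refine Finset.card_lt_card ⟨Finset.filter_subset _ _, fun hsub => ?_⟩
  have := hsub hi
  simp at this

lemma exists_rank_eq {A : Finset (Fin K)} {r : ℕ} (hr : r < A.card) : ∃ i ∈ A, rank A i = r := by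
  have h := Finset.surjOn_of_injOn_of_card_le (s := A) (t := Finset.range A.card) (rank A)
    (fun i hi => by simpa using rank_lt_card hi) (rank_strictMonoOn A).injOn (by simp)
  obtain ⟨i, hi, hir⟩ := h (show r ∈ (Finset.range A.card : Set ℕ) by simpa using hr)
  exact ⟨i, hi, hir⟩

lemma candidates_subset (δ : ℝ) (A : Finset (Fin K)) (h : History K) : candidates δ A h ⊆ A := by
  unfold candidates
  split_ifs <;> exact Finset.filter_subset _ _

lemma candidates_nonempty (δ : ℝ) {A : Finset (Fin K)} (hA : A.Nonempty) (h : History K) :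
    (candidates δ A h).Nonempty := by
  unfold candidates
  split_ifs
  · obtain ⟨i, hi, hir⟩ := exists_rank_eq (Nat.mod_lt h.length hA.card_pos)
    refine ⟨i, Finset.mem_filter.2 ⟨hi, ?_⟩⟩
    rw [← hir, rank]
  · obtain ⟨i, hi, hmax⟩ := Finset.exists_max_image A
      (fun i => varUCB δ h i / (numPulls h i : ℝ)) hA
    exact ⟨i, Finset.mem_filter.2 ⟨hi, hmax⟩⟩

section Stage

variable (τ : TieBreak K) (δ : ℝ) (s : ℕ) {A : Finset (Fin K)}
  (y : ℕ → Fin K → ℝ)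

lemma pulledArm_mem_candidates (hA : A.Nonempty) (t : ℕ) :
    pulledArm τ δ s A y t ∈ candidates δ A (stageHistory τ δ s A y t) :=
  τ.arm_mem s t _ (candidates_nonempty δ hA _)

lemma numPulls_stageHistory_succ (t : ℕ) (j : Fin K) :
    numPulls (stageHistory τ δ s A y (t + 1)) j
      = numPulls (stageHistory τ δ s A y t) j + if pulledArm τ δ s A y t = j then 1 else 0 := by
  unfold numPulls
  rw [rewards_stageHistory_succ]
  split_ifs <;> simp

lemma numPulls_stageHistory_monotone (j : Fin K) :
    Monotone fun t => numPulls (stageHistory τ δ s A y t) j :=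
  monotone_nat_of_le_succ fun t => by
    rw [numPulls_stageHistory_succ]
    exact Nat.le_add_right _ _

lemma sum_numPulls_stageHistory (hA : A.Nonempty) (t : ℕ) :
    ∑ j ∈ A, numPulls (stageHistory τ δ s A y t) j = t := by
  induction t with
  | zero => simp [stageHistory, numPulls, rewards]
  | succ t ih =>
    simp only [numPulls_stageHistory_succ, Finset.sum_add_distrib, ih, Finset.sum_ite_eq]
    rw [if_pos (candidates_subset δ A _ (pulledArm_mem_candidates τ δ s y hA t))]

lemma pulledArm_eq_iff_of_roundRobin (hA : A.Nonempty) {t : ℕ}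
    (ht : t < A.card * initPulls δ) {j : Fin K} (hj : j ∈ A) : pulledArm τ δ s A y t = j ↔ rank A j = t % A.card := by
  have h := pulledArm_mem_candidates τ δ s y hA t
  have hmem := candidates_subset δ A _ h
  rw [candidates, length_stageHistory, if_pos ht, Finset.mem_filter] at h
  have hr : rank A (pulledArm τ δ s A y t) = t % A.card := by
    rw [← h.2, rank]
  constructor
  · rintro rfl
    exact hr
  · intro h'
    exact (rank_strictMonoOn A).injOn hmem hj (hr.trans h'.symm)

/-- The initial rounds pull every remaining arm exactly `initPulls δ` times. -/
lemma numPulls_stageHistory_init (hA : A.Nonempty) {j : Fin K} (hj : j ∈ A) :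
    numPulls (stageHistory τ δ s A y (A.card * initPulls δ)) j = initPulls δ := by
  have key : ∀ t ≤ A.card * initPulls δ, numPulls (stageHistory τ δ s A y t) j
      = t.count (· ≡ rank A j [MOD A.card]) := by
    intro t ht
    induction t with
    | zero => simp [stageHistory, numPulls, rewards]
    | succ t ih =>
      rw [numPulls_stageHistory_succ, ih (by omega), Nat.count_succ]
      congr 1
      have := pulledArm_eq_iff_of_roundRobin τ δ s y hA (t := t) (by omega) hj
      have h2 : t ≡ rank A j [MOD A.card] ↔ rank A j = t % A.card := by
        rw [Nat.ModEq, Nat.mod_eq_of_lt (rank_lt_card hj), eq_comm]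
      simp only [this, h2]
  rw [key _ le_rfl, Nat.count_modEq_card _ hA.card_pos]
  simp [hA.card_pos]

lemma varUCB_div_le_of_not_roundRobin (hA : A.Nonempty) {t : ℕ} (ht : A.card * initPulls δ ≤ t)
    {i : Fin K} (hi : i ∈ A) :
    varUCB δ (stageHistory τ δ s A y t) i / (numPulls (stageHistory τ δ s A y t) i : ℝ)
      ≤ varUCB δ (stageHistory τ δ s A y t) (pulledArm τ δ s A y t)
        / (numPulls (stageHistory τ δ s A y t) (pulledArm τ δ s A y t) : ℝ) := by
  have h := pulledArm_mem_candidates τ δ s y hA t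
  rw [candidates, length_stageHistory, if_neg (not_lt.2 ht), Finset.mem_filter] at h
  exact h.2 i hi

/-- An arm that ends up with more pulls than the round-robin gives it was last pulled in an
adaptive round. -/
lemma exists_last_pull {T : ℕ} (hA : A.Nonempty) {j : Fin K} (hj : j ∈ A)
    (hN : initPulls δ < numPulls (stageHistory τ δ s A y T) j) :
    ∃ t < T, A.card * initPulls δ ≤ t ∧ pulledArm τ δ s A y t = j ∧
      numPulls (stageHistory τ δ s A y t) j + 1 = numPulls (stageHistory τ δ s A y T) j := by
  induction T with
  | zero => simp [stageHistory, numPulls, rewards] at hN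
  | succ T ih =>
    by_cases hp : pulledArm τ δ s A y T = j
    · refine ⟨T, T.lt_succ_self, ?_, hp, ?_⟩
      · by_contra! hlt
        have := numPulls_stageHistory_monotone τ δ s (A := A) y j (show T + 1 ≤ _ from hlt)
        simp only [numPulls_stageHistory_init τ δ s y hA hj] at this
        omega
      · rw [numPulls_stageHistory_succ, if_pos hp]
    · rw [numPulls_stageHistory_succ, if_neg hp, add_zero] at hN ⊢
      obtain ⟨t, ht, h⟩ := ih hN
      exact ⟨t, ht.trans T.lt_succ_self, h⟩

end Stage

/-! ### The lower bound on the number of pulls in a stage -/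

/-- The comparison of the indices of two arms with `a` and `c` pulls: a lower confidence bound for
the first and an upper confidence bound for the second bound `a` from below. -/
lemma pulls_lower_bound_of_index_le {x D a c v w V W S : ℝ} (hx : 0 < x) (hD : 4 * x < D)
    (ha : 4 * x < a - 1) (hc : D ≤ c - 1) (hv : 0 ≤ v) (hwS : w ≤ S) (hS : 0 < S)
    (hV : v * (1 - 2 * √(x / (a - 1))) ≤ V)
    (hW : W ≤ w * (1 + 2 * √(x / (c - 1)) + 2 * √(x / (c - 1)) ^ 2))
    (hidx : V / (1 - 2 * √(x / (a - 1))) / a ≤ W / (1 - 2 * √(x / (c - 1))) / c) :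
    v / S * ((1 - 2 * √(x / D)) / (1 + 2 * √(x / D) + 2 * x / D)) * (D + 1) ≤ a := by
  have hsq : ∀ {d : ℝ}, 4 * x < d → √(x / d) < 1 / 2 := by
    intro d hd
    rw [Real.sqrt_lt' (by norm_num), div_lt_iff₀ (by linarith)]
    linarith
  have hD0 : 0 < D := by linarith
  have ha0 : 0 < a := by linarith
  have hc0 : 0 < c := by linarith
  have hg := hsq ha
  have hu := hsq (hD.trans_le hc)
  have hb := hsq hD
  have hub : √(x / (c - 1)) ≤ √(x / D) := Real.sqrt_le_sqrt (by gcongr)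
  have hu0 : 0 ≤ √(x / (c - 1)) := Real.sqrt_nonneg _
  have hbsq : 2 * x / D = 2 * √(x / D) ^ 2 := by
    rw [Real.sq_sqrt (by positivity)]
    ring
  rw [hbsq]
  generalize √(x / (a - 1)) = g at *
  generalize √(x / (c - 1)) = u at *
  generalize √(x / D) = b at *
  have h1 : v ≤ V / (1 - 2 * g) := by
    rw [le_div_iff₀ (by linarith)]
    exact hV
  have h2 : W / (1 - 2 * u) ≤ S * (1 + 2 * b + 2 * b ^ 2) / (1 - 2 * b) := by
    have : w * (1 + 2 * u + 2 * u ^ 2) ≤ S * (1 + 2 * b + 2 * b ^ 2) := by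
      have : 1 + 2 * u + 2 * u ^ 2 ≤ 1 + 2 * b + 2 * b ^ 2 := by gcongr
      exact mul_le_mul hwS this (by positivity) hS.le
    calc W / (1 - 2 * u) ≤ S * (1 + 2 * b + 2 * b ^ 2) / (1 - 2 * u) :=
          div_le_div_of_nonneg_right (hW.trans this) (by linarith)
      _ ≤ _ := by
          have : 0 ≤ b := hu0.trans hub
          exact div_le_div_of_nonneg_left (by positivity) (by linarith) (by linarith)
  have hb0 : 0 ≤ b := hu0.trans hub
  have h3 : v / a ≤ S * (1 + 2 * b + 2 * b ^ 2) / (1 - 2 * b) / c :=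
    (div_le_div_of_nonneg_right h1 ha0.le).trans
      (hidx.trans (div_le_div_of_nonneg_right h2 hc0.le))
  have hb1 : 0 < 1 - 2 * b := by linarith
  have hQ : 0 < 1 + 2 * b + 2 * b ^ 2 := by positivity
  rw [div_div, div_le_div_iff₀ ha0 (by positivity)] at h3
  have h4 : v / S * ((1 - 2 * b) / (1 + 2 * b + 2 * b ^ 2)) * c ≤ a := by
    rw [div_mul_div_comm, div_mul_eq_mul_div, div_le_iff₀ (by positivity)]
    linarith
  refine le_trans (mul_le_mul_of_nonneg_left (by linarith) ?_) h4
  positivity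

lemma alpha_le_one {k n δ : ℝ} (hδ0 : 0 < δ) (hδ1 : δ < 1) (h : 2 < n / k) :
    alpha k n δ ≤ 1 := by
  have hx : 0 < Real.log (1 / δ) := Real.log_pos (by rw [lt_div_iff₀ hδ0]; linarith)
  have hD : 0 < n / k - 2 := by linarith
  unfold alpha
  have h1 : 0 ≤ √(Real.log (1 / δ) / (n / k - 2)) := Real.sqrt_nonneg _
  have h2 : 0 ≤ 2 * Real.log (1 / δ) / (n / k - 2) := by positivity
  rw [div_le_one (by positivity)]
  linarith

/-- When the lower confidence bounds hold for arms with less than `T / |A| - 1` pulls and the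
upper ones for the other arms, every arm is pulled as often as claimed: the arm that is pulled at
least `T / |A|` times has the largest index in the round of its last pull. -/
theorem numPulls_lower_bound (τ : TieBreak K) {δ : ℝ} (hδ0 : 0 < δ) (hδ1 : δ < 1) (s T : ℕ)
    {A : Finset (Fin K)} (y : ℕ → Fin K → ℝ) (σ : Fin K → ℝ≥0) (hσ : 0 < sigmaMax σ)
    (hT : 2 * A.card < T)
    (hlow : ∀ t < T, ∀ i ∈ A, 2 ≤ numPulls (stageHistory τ δ s A y t) i →
      (numPulls (stageHistory τ δ s A y t) i : ℝ) < (T : ℝ) / A.card - 1 →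
      (σ i : ℝ) ^ 2 * (1 - 2 * √(Real.log (1 / δ)
        / ((numPulls (stageHistory τ δ s A y t) i : ℝ) - 1)))
        ≤ empVar (stageHistory τ δ s A y t) i)
    (hup : ∀ t < T, ∀ i ∈ A, 2 ≤ numPulls (stageHistory τ δ s A y t) i →
      (T : ℝ) / A.card - 1 ≤ numPulls (stageHistory τ δ s A y t) i →
      empVar (stageHistory τ δ s A y t) i ≤ (σ i : ℝ) ^ 2 * (1 + 2 * √(Real.log (1 / δ)
        / ((numPulls (stageHistory τ δ s A y t) i : ℝ) - 1)) + 2 * √(Real.log (1 / δ)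
        / ((numPulls (stageHistory τ δ s A y t) i : ℝ) - 1)) ^ 2))
    {i : Fin K} (hi : i ∈ A) :
    (σ i : ℝ) ^ 2 / (sigmaMax σ : ℝ) ^ 2 * alpha (A.card : ℝ) (T : ℝ) δ
        * ((T : ℝ) / (A.card : ℝ) - 1)
      ≤ (numPulls (stageHistory τ δ s A y T) i : ℝ) := by
  have hA : A.Nonempty := ⟨i, hi⟩
  have hk : (0 : ℝ) < A.card := by exact_mod_cast hA.card_pos
  have hx : 0 < Real.log (1 / δ) := Real.log_pos (by rw [lt_div_iff₀ hδ0]; linarith)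
  have hTk : 2 < (T : ℝ) / A.card := by
    rw [lt_div_iff₀ hk]
    exact_mod_cast hT
  have hσle : ∀ j, (σ j : ℝ) ^ 2 ≤ (sigmaMax σ : ℝ) ^ 2 := fun j => by
    have : σ j ≤ sigmaMax σ := Finset.le_sup (f := σ) (Finset.mem_univ j)
    exact pow_le_pow_left₀ (σ j).coe_nonneg (by exact_mod_cast this) 2
  have hS : (0 : ℝ) < (sigmaMax σ : ℝ) ^ 2 := by
    have : (0 : ℝ) < sigmaMax σ := by exact_mod_cast hσ
    positivity
  have hratio : (σ i : ℝ) ^ 2 / (sigmaMax σ : ℝ) ^ 2 ≤ 1 := (div_le_one hS).2 (hσle i)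
  have hratio0 : 0 ≤ (σ i : ℝ) ^ 2 / (sigmaMax σ : ℝ) ^ 2 := by positivity
  by_cases hx4 : 4 * Real.log (1 / δ) < (T : ℝ) / A.card - 2
  swap
  · -- The factor `alpha` is not positive.
    have hs : 1 / 2 ≤ √(Real.log (1 / δ) / ((T : ℝ) / A.card - 2)) := by
      rw [Real.le_sqrt' (by norm_num), le_div_iff₀ (by linarith)]
      linarith
    have hα : alpha (A.card : ℝ) (T : ℝ) δ ≤ 0 := by
      unfold alpha
      have : 0 < (T : ℝ) / A.card - 2 := by linarith
      exact div_nonpos_of_nonpos_of_nonneg (by linarith) (by positivity)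
    refine le_trans ?_ (Nat.cast_nonneg _)
    exact mul_nonpos_of_nonpos_of_nonneg (mul_nonpos_of_nonneg_of_nonpos hratio0 hα)
      (by linarith)
  by_cases hlarge : (T : ℝ) / A.card - 1 ≤ numPulls (stageHistory τ δ s A y T) i
  · -- The factors in front of `T / |A| - 1` are at most one.
    refine le_trans ?_ hlarge
    have : (σ i : ℝ) ^ 2 / (sigmaMax σ : ℝ) ^ 2 * alpha (A.card : ℝ) (T : ℝ) δ ≤ 1 :=
      (mul_le_mul_of_nonneg_left (alpha_le_one hδ0 hδ1 hTk) hratio0).trans (by linarith)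
    exact mul_le_of_le_one_left (by linarith) this
  push Not at hlarge
  have hL : (initPulls δ : ℝ) ≤ 4 * Real.log (1 / δ) + 2 := by
    have := Nat.floor_le (show 0 ≤ 4 * Real.log (1 / δ) + 1 by positivity)
    unfold initPulls
    push_cast
    linarith
  have hL' : 4 * Real.log (1 / δ) + 1 < initPulls δ := by
    have := Nat.lt_floor_add_one (4 * Real.log (1 / δ) + 1)
    unfold initPulls
    exact_mod_cast this
  -- The pulls add up to `T`, so some arm receives at least the average.
  obtain ⟨j, hj, hjT⟩ : ∃ j ∈ A, (T : ℝ) / A.card ≤ numPulls (stageHistory τ δ s A y T) j := by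
    by_contra! hcon
    have h1 := Finset.sum_lt_sum_of_nonempty hA hcon
    rw [← Nat.cast_sum, sum_numPulls_stageHistory τ δ s y hA T, Finset.sum_const, nsmul_eq_mul,
      mul_div_cancel₀ _ hk.ne'] at h1
    exact lt_irrefl _ h1
  have hLj : initPulls δ < numPulls (stageHistory τ δ s A y T) j := by
    have : (initPulls δ : ℝ) < numPulls (stageHistory τ δ s A y T) j := by linarith
    exact_mod_cast this
  obtain ⟨t, htT, htL, hpj, hNj⟩ := exists_last_pull τ δ s y hA hj hLj
  have hidx := varUCB_div_le_of_not_roundRobin τ δ s y hA htL hi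
  rw [hpj] at hidx
  have hmono := numPulls_stageHistory_monotone τ δ s (A := A) y i htT.le
  have hpi := numPulls_stageHistory_monotone τ δ s (A := A) y i htL
  have hpj' := numPulls_stageHistory_monotone τ δ s (A := A) y j htL
  simp only [numPulls_stageHistory_init τ δ s y hA hi] at hpi
  simp only [numPulls_stageHistory_init τ δ s y hA hj] at hpj'
  simp only at hmono
  have hNj' : (numPulls (stageHistory τ δ s A y t) j : ℝ) + 1
      = numPulls (stageHistory τ δ s A y T) j := by exact_mod_cast hNj
  have hmono' : (numPulls (stageHistory τ δ s A y t) i : ℝ)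
      ≤ numPulls (stageHistory τ δ s A y T) i := by exact_mod_cast hmono
  have hpi' : (initPulls δ : ℝ) ≤ numPulls (stageHistory τ δ s A y t) i := by exact_mod_cast hpi
  have hL2 : 2 ≤ initPulls δ := by
    have : (1 : ℝ) < initPulls δ := by linarith
    exact_mod_cast this
  have hVi := hlow t htT i hi (hL2.trans hpi) (by linarith)
  have hVj := hup t htT j hj (hL2.trans hpj') (by linarith)
  refine le_trans ?_ hmono'
  have := pulls_lower_bound_of_index_le (D := (T : ℝ) / A.card - 2) hx hx4 (by linarith)
    (by linarith) (sq_nonneg (σ i : ℝ)) (hσle j) hS hVi hVj hidx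
  have e : (T : ℝ) / A.card - 2 + 1 = (T : ℝ) / A.card - 1 := by ring
  rw [e] at this
  exact this

end SHAdaVar

/-! ### Concentration of the empirical variances along the run -/

namespace SHAdaVar

variable {K : ℕ}

lemma foldl_sampleStep_of_full (N : ℕ) (f : ℝ → ℝ) (l : List ℝ) (x : ℕ × ℝ × ℝ) (hx : x.1 = N) :
    l.foldl (fun x y => sampleStep N x (f y)) x = x := by
  induction l with
  | nil => rfl
  | cons a l ih =>
    have : sampleStep N x (f a) = x := by simp [sampleStep, hx]
    rw [List.foldl_cons, this, ih]

lemma foldl_sampleStep_of_length_le (N : ℕ) (f : ℝ → ℝ) (l : List ℝ) (hl : l.length ≤ N) :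
    l.foldl (fun x y => sampleStep N x (f y)) (0, 0, 0)
      = (l.length, (l.map f).sum, (l.map fun y => f y ^ 2).sum) := by
  induction l using List.reverseRecOn with
  | nil => rfl
  | append_singleton l a ih =>
    rw [List.length_append, List.length_singleton] at hl
    rw [List.foldl_append, ih (by omega)]
    simp [sampleStep, show l.length < N by omega]

section Stage

variable (τ : TieBreak K) (δ : ℝ) (s : ℕ) (A : Finset (Fin K)) (y : ℕ → Fin K → ℝ)

lemma rewards_stageHistory_prefix (i : Fin K) {t T : ℕ} (h : t ≤ T) :
    rewards (stageHistory τ δ s A y t) i <+: rewards (stageHistory τ δ s A y T) i := by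
  induction T, h using Nat.le_induction with
  | base => exact List.prefix_rfl
  | succ T _ ih =>
    rw [rewards_stageHistory_succ]
    split_ifs
    · exact ih.trans (List.prefix_append _ _)
    · exact ih

lemma exists_of_mem_rewards_stageHistory (i : Fin K) (t : ℕ) :
    ∀ z ∈ rewards (stageHistory τ δ s A y t) i, ∃ u, z = y u i := by
  induction t with
  | zero => simp [stageHistory, rewards]
  | succ t ih =>
    intro z hz
    rw [rewards_stageHistory_succ] at hz
    split_ifs at hz
    · rcases List.mem_append.1 hz with hz | hz
      · exact ih z hz
      · exact ⟨t, by simpa using hz⟩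
    · exact ih z hz

/-- The statistics of the first `N` standardized rewards of arm `i` among the first `t` rounds. -/
noncomputable def standardizedStats (N : ℕ) (i : Fin K) (m c : ℝ) (t : ℕ) : ℕ × ℝ × ℝ :=
  (rewards (stageHistory τ δ s A y t) i).foldl (fun x z => sampleStep N x ((z - m) / c)) (0, 0, 0)

/-- When arm `i` has been pulled `N` times, the statistics of its first `N` rewards are those of the
current history, and they do not change later. -/
lemma standardizedStats_eq (i : Fin K) (m c : ℝ) {t T : ℕ} (h : t ≤ T) :
    standardizedStats τ δ s A y (numPulls (stageHistory τ δ s A y t) i) i m c T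
      = (numPulls (stageHistory τ δ s A y t) i,
        ((rewards (stageHistory τ δ s A y t) i).map fun z => (z - m) / c).sum,
        ((rewards (stageHistory τ δ s A y t) i).map fun z => ((z - m) / c) ^ 2).sum) := by
  obtain ⟨l, hl⟩ := rewards_stageHistory_prefix τ δ s A y i h
  rw [standardizedStats, ← hl, List.foldl_append]
  have := foldl_sampleStep_of_length_le (numPulls (stageHistory τ δ s A y t) i)
    (fun z => (z - m) / c) (rewards (stageHistory τ δ s A y t) i) le_rfl
  rw [this]
  exact foldl_sampleStep_of_full _ (fun z => (z - m) / c) l _ rfl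

end Stage

lemma empVar_nonneg (h : History K) (i : Fin K) (hN : 1 ≤ numPulls h i) : 0 ≤ empVar h i := by
  have : (1 : ℝ) ≤ numPulls h i := by exact_mod_cast hN
  refine div_nonneg (List.sum_nonneg ?_) (by linarith)
  intro z hz
  obtain ⟨y, -, rfl⟩ := List.mem_map.1 hz
  positivity

lemma empVar_eq_zero_of_const (h : History K) (i : Fin K) (m : ℝ)
    (hm : ∀ z ∈ rewards h i, z = m) : empVar h i = 0 := by
  have hr := List.eq_replicate_of_mem hm
  rw [empVar_eq h i m 1 one_ne_zero, hr]
  simp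

section Probability

variable {Ω : Type*} {n : ℕ} {μ : Fin K → ℝ} {σ : Fin K → ℝ≥0} {Y : ℕ → ℕ → Fin K → Ω → ℝ}

/-- The information of the rewards before round `t` of stage `s`. -/
@[reducible]
def pastRewards (Y : ℕ → ℕ → Fin K → Ω → ℝ) (s t : ℕ) : MeasurableSpace Ω :=
  ⨆ p ∈ {p : ℕ × ℕ × Fin K | p.1 < s ∨ (p.1 = s ∧ p.2.1 < t)},
    MeasurableSpace.comap (Y p.1 p.2.1 p.2.2) inferInstance

lemma measurable_pastRewards {s t r u : ℕ} (h : r < s ∨ (r = s ∧ u < t)) (i : Fin K) :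
    Measurable[pastRewards Y s t] (Y r u i) := by
  refine Measurable.of_comap_le ?_
  exact le_iSup₂ (f := fun (p : ℕ × ℕ × Fin K)
    (_ : p ∈ {p : ℕ × ℕ × Fin K | p.1 < s ∨ (p.1 = s ∧ p.2.1 < t)}) =>
    MeasurableSpace.comap (Y p.1 p.2.1 p.2.2) inferInstance) (r, u, i) h

lemma indep_pastRewards [MeasurableSpace Ω] {P : Measure Ω} (hYmeas : ∀ s t i, Measurable (Y s t i))
    (hYindep : iIndepFun (fun (p : ℕ × ℕ × Fin K) => Y p.1 p.2.1 p.2.2) P) (s t : ℕ) (i : Fin K) :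
    Indep (pastRewards Y s t) (MeasurableSpace.comap (Y s t i) inferInstance) P := by
  have h := indep_iSup_of_disjoint
    (m := fun p : ℕ × ℕ × Fin K => MeasurableSpace.comap (Y p.1 p.2.1 p.2.2) inferInstance)
    (fun p => (hYmeas _ _ _).comap_le) ((iIndepFun_iff_iIndep _ _ _).1 hYindep)
    (S := {p | p.1 < s ∨ (p.1 = s ∧ p.2.1 < t)}) (T := {(s, t, i)}) (by simp)
  simpa [pastRewards] using h

variable [MeasurableSpace Ω] {P : Measure Ω} [IsProbabilityMeasure P]

/-- Potentials do not increase in mean along the standardized rewards of an arm in a stage, although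
the rounds in which it is pulled are random. -/
lemma lintegral_samplePotential_standardizedStats_le (τ : TieBreak K) (δ : ℝ)
    (hYmeas : ∀ s t i, Measurable (Y s t i))
    (hYlaw : ∀ s t i, P.map (Y s t i) = gaussianReal (μ i) (σ i ^ 2))
    (hYindep : iIndepFun (fun (p : ℕ × ℕ × Fin K) => Y p.1 p.2.1 p.2.2) P)
    (s N : ℕ) (i : Fin K) (hσ : 0 < σ i) (t : ℕ) {l : ℝ} (hl : l < 1 / 2) :
    Measurable (fun ω => standardizedStats τ δ s (activeArms τ δ n (fun s t i => Y s t i ω) s)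
        (fun t i => Y s t i ω) N i (μ i) (σ i) t) ∧
      ∫⁻ ω, ENNReal.ofReal (samplePotential N l
        (standardizedStats τ δ s (activeArms τ δ n (fun s t i => Y s t i ω) s)
          (fun t i => Y s t i ω) N i (μ i) (σ i) t)) ∂P
        ≤ ENNReal.ofReal (samplePotential N l (0, 0, 0)) := by
  have hσ0 : (σ i : ℝ) ≠ 0 := by exact_mod_cast hσ.ne'
  have hst : Measurable (Function.uncurry
      fun (x : ℕ × ℝ × ℝ) (z : ℝ) => sampleStep N x ((z - μ i) / σ i)) :=
    (measurable_sampleStep N).comp (f := fun w : (ℕ × ℝ × ℝ) × ℝ => (w.1, (w.2 - μ i) / σ i))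
      (by fun_prop)
  have hV : Measurable fun e => ENNReal.ofReal (samplePotential N l e) :=
    ENNReal.measurable_ofReal.comp (measurable_samplePotential N l)
  have hmap : (gaussianReal (μ i) (σ i ^ 2)).map (fun z => (z - μ i) / σ i)
      = gaussianReal 0 1 := by
    have : (fun z => (z - μ i) / (σ i : ℝ)) = (fun z => z / (σ i : ℝ)) ∘ fun z => z - μ i := rfl
    rw [this, ← Measure.map_map (by fun_prop) (by fun_prop), gaussianReal_map_sub_const,
      gaussianReal_map_div_const, sub_self, zero_div]
    congr 1
    ext
    push_cast
    exact div_self (pow_ne_zero 2 hσ0)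
  have hle : ∀ t, pastRewards Y s t ≤ ‹MeasurableSpace Ω› := fun t =>
    iSup₂_le fun p _ => (hYmeas _ _ _).comap_le
  have hmono : Monotone (pastRewards Y s) := fun t t' h => by
    refine biSup_mono fun p hp => ?_
    rcases hp with hp | hp
    · exact Or.inl hp
    · exact Or.inr ⟨hp.1, hp.2.trans_le h⟩
  refine lintegral_predictable_selection_le P (gaussianReal (μ i) (σ i ^ 2)) (pastRewards Y s) hle
    hmono (fun t => Y s t i) (fun t => hYmeas s t i)
    (fun t => measurable_pastRewards (Or.inr ⟨rfl, t.lt_succ_self⟩) i) (fun t => hYlaw s t i)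
    (fun t => indep_pastRewards hYmeas hYindep s t i)
    (fun t => {ω | pulledArm τ δ s (activeArms τ δ n (fun s t i => Y s t i ω) s)
      (fun t i => Y s t i ω) t = i}) (fun t => ?_)
    (fun x z => sampleStep N x ((z - μ i) / σ i)) hst
    (fun e => ENNReal.ofReal (samplePotential N l e)) hV (fun e => ?_)
    (fun t ω => standardizedStats τ δ s (activeArms τ δ n (fun s t i => Y s t i ω) s)
      (fun t i => Y s t i ω) N i (μ i) (σ i) t) (0, 0, 0) (fun ω => rfl)
    (fun t ω h => ?_) (fun t ω h => ?_) t
  · exact @measurableSet_pulledArm_eq K Ω (pastRewards Y s t) τ δ n s t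
      (fun ω s t i => Y s t i ω) (fun r hr u j => measurable_pastRewards (Or.inl hr) j)
      (fun u hu j => measurable_pastRewards (Or.inr ⟨rfl, hu⟩) j) i
  · rw [← lintegral_samplePotential_sampleStep N l hl e, ← hmap, lintegral_map
      (f := fun z => ENNReal.ofReal (samplePotential N l (sampleStep N e z)))
      (hV.comp ((measurable_sampleStep N).comp (measurable_const.prodMk measurable_id)))
      (by fun_prop)]
  · simp only [Set.mem_ofPred_eq] at h
    simp only [standardizedStats, rewards_stageHistory_succ, if_pos h, List.foldl_append,
      List.foldl_cons, List.foldl_nil]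
  · simp only [Set.mem_ofPred_eq] at h
    simp only [standardizedStats, rewards_stageHistory_succ, if_neg h]

/-- The event that, with `N` pulls of arm `i` in stage `s`, the empirical variance leaves its
confidence interval: on the left if `lower` holds, and on the right otherwise. -/
def varianceFailure (τ : TieBreak K) (δ : ℝ) (n : ℕ) (σ : Fin K → ℝ≥0)
    (Y : ℕ → ℕ → Fin K → Ω → ℝ) (lower : Prop) (s : ℕ) (i : Fin K) (N : ℕ) : Set Ω :=
  {ω | ∃ t < stageBudget K n, ∃ h, h = stageHistory τ δ s
      (activeArms τ δ n (fun s t i => Y s t i ω) s) (fun t i => Y s t i ω) t ∧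
    numPulls h i = N ∧
    ((lower ∧ empVar h i < (σ i : ℝ) ^ 2 * (1 - 2 * √(Real.log (1 / δ) / ((N : ℝ) - 1)))) ∨
      (¬ lower ∧ (σ i : ℝ) ^ 2 * (1 + 2 * √(Real.log (1 / δ) / ((N : ℝ) - 1))
        + 2 * √(Real.log (1 / δ) / ((N : ℝ) - 1)) ^ 2) < empVar h i))}

theorem measure_varianceFailure_le (τ : TieBreak K) {δ : ℝ} (hδ0 : 0 < δ) (hδ1 : δ < 1)
    (hYmeas : ∀ s t i, Measurable (Y s t i))
    (hYlaw : ∀ s t i, P.map (Y s t i) = gaussianReal (μ i) (σ i ^ 2))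
    (hYindep : iIndepFun (fun (p : ℕ × ℕ × Fin K) => Y p.1 p.2.1 p.2.2) P)
    (lower : Prop) (s : ℕ) (i : Fin K) {N : ℕ} (hN : 2 ≤ N) :
    P (varianceFailure τ δ n σ Y lower s i N) ≤ ENNReal.ofReal δ := by
  have hN2 : (2 : ℝ) ≤ N := by exact_mod_cast hN
  have hd : 0 < (N : ℝ) - 1 := by linarith
  have hx : 0 < Real.log (1 / δ) := Real.log_pos (by rw [lt_div_iff₀ hδ0]; linarith)
  have hu : 0 ≤ √(Real.log (1 / δ) / ((N : ℝ) - 1)) := Real.sqrt_nonneg _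
  have hexp : Real.exp (-(((N : ℝ) - 1) * √(Real.log (1 / δ) / ((N : ℝ) - 1)) ^ 2)) = δ := by
    rw [Real.sq_sqrt (by positivity), mul_div_cancel₀ _ hd.ne', one_div, Real.log_inv, neg_neg,
      Real.exp_log hδ0]
  rcases (zero_le : 0 ≤ σ i).eq_or_lt with hσ | hσ
  · -- A degenerate arm has constant rewards, hence no empirical variance.
    have hae : ∀ᵐ ω ∂P, ∀ t, Y s t i ω = μ i := by
      rw [ae_all_iff]
      intro t
      have h := hYlaw s t i
      rw [← hσ, zero_pow two_ne_zero, gaussianReal_zero_var] at h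
      have h2 : ∀ᵐ z ∂(P.map (Y s t i)), z = μ i := by
        rw [h, ae_dirac_eq]
        simp
      exact ae_of_ae_map (hYmeas s t i).aemeasurable h2
    refine (le_of_eq ?_).trans zero_le
    refine measure_mono_null ?_ hae
    rintro ω ⟨t, -, h, rfl, hn, hbad⟩ hω
    rw [← hσ, NNReal.coe_zero, zero_pow two_ne_zero, zero_mul, zero_mul,
      empVar_eq_zero_of_const _ i (μ i)] at hbad
    · simp at hbad
    · intro z hz
      obtain ⟨u, rfl⟩ := exists_of_mem_rewards_stageHistory _ _ _ _ _ _ _ z hz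
      exact hω u
  have hσ' : (0 : ℝ) < σ i := by exact_mod_cast hσ
  have key := fun l (hl : l < 1 / 2) => lintegral_samplePotential_standardizedStats_le (n := n)
    τ δ hYmeas hYlaw hYindep s N i hσ (stageBudget K n) hl
  have hm := (key 0 (by norm_num)).1
  by_cases hlow : lower
  · refine (measure_mono ?_).trans ((measure_sampleDeviation_lower_le (by omega) hm
      (fun l hl => (key l hl).2) hu).trans (by rw [hexp]))
    rintro ω ⟨t, ht, h, rfl, hn, hbad⟩
    rcases hbad with ⟨-, hbad⟩ | ⟨hbad, -⟩
    swap
    · exact absurd hlow hbad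
    have e := standardizedStats_eq τ δ s (activeArms τ δ n (fun s t i => Y s t i ω) s)
      (fun t i => Y s t i ω) i (μ i) (σ i) ht.le
    rw [empVar_eq _ i (μ i) _ hσ'.ne', hn, div_lt_iff₀ hd] at hbad
    rw [hn] at e
    simp only [Set.mem_ofPred_eq, e, true_and]
    refine lt_of_mul_lt_mul_left (hbad.trans_eq ?_) (sq_nonneg (σ i : ℝ))
    ring
  · refine (measure_mono ?_).trans ((measure_sampleDeviation_upper_le (by omega) hm
      (fun l hl => (key l hl).2) hu).trans (by rw [hexp]))
    rintro ω ⟨t, ht, h, rfl, hn, hbad⟩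
    rcases hbad with ⟨hbad, -⟩ | ⟨-, hbad⟩
    · exact absurd hbad hlow
    have e := standardizedStats_eq τ δ s (activeArms τ δ n (fun s t i => Y s t i ω) s)
      (fun t i => Y s t i ω) i (μ i) (σ i) ht.le
    rw [empVar_eq _ i (μ i) _ hσ'.ne', hn, lt_div_iff₀ hd] at hbad
    rw [hn] at e
    simp only [Set.mem_ofPred_eq, e, true_and]
    refine lt_of_mul_lt_mul_left (lt_of_eq_of_lt ?_ hbad) (sq_nonneg (σ i : ℝ))
    ring

end Probability

end SHAdaVar

/-! ### The union bound -/

theorem mainTheorem4 {Ω : Type*} [MeasurableSpace Ω] (P : Measure Ω) [IsProbabilityMeasure P]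
    (K n : ℕ) (δ : ℝ) (hδ0 : 0 < δ) (hδ1 : δ < 1)
    (μ : Fin K → ℝ) (σ : Fin K → ℝ≥0) (hσ : ∃ i, 0 < σ i)
    (Y : ℕ → ℕ → Fin K → Ω → ℝ)
    (hYmeas : ∀ s t i, Measurable (Y s t i))
    (hYlaw : ∀ s t i, P.map (Y s t i) = gaussianReal (μ i) (σ i ^ 2))
    (hYindep : iIndepFun (fun (p : ℕ × ℕ × Fin K) => Y p.1 p.2.1 p.2.2) P)
    (τ : SHAdaVar.TieBreak K) :
    1 - (K : ℝ) * n * δ ≤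
      P.real {ω | ∀ s < SHAdaVar.numStages K,
        2 * (SHAdaVar.activeArms τ δ n (fun s t i => Y s t i ω) s).card
            < SHAdaVar.stageBudget K n →
        ∀ i ∈ SHAdaVar.activeArms τ δ n (fun s t i => Y s t i ω) s,
          (σ i : ℝ) ^ 2 / (SHAdaVar.sigmaMax σ : ℝ) ^ 2
              * SHAdaVar.alpha
                  ((SHAdaVar.activeArms τ δ n (fun s t i => Y s t i ω) s).card : ℝ)
                  (SHAdaVar.stageBudget K n : ℝ) δ
              * ((SHAdaVar.stageBudget K n : ℝ)
                  / ((SHAdaVar.activeArms τ δ n (fun s t i => Y s t i ω) s).card : ℝ) - 1)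
            ≤ (SHAdaVar.stagePulls τ δ n (fun s t i => Y s t i ω) s i : ℝ)} := by
  classical
  -- With `N` pulls of an arm, only one of the two confidence bounds is needed: the lower one if
  -- `N` is below `stageBudget K n / |A| - 1`, the upper one otherwise. So the union bound has one
  -- event for each stage, arm and number of pulls, that is, at most `K * n` events.
  let lower : ℕ → ℕ → Prop := fun s N =>
    (N : ℝ) < (SHAdaVar.stageBudget K n : ℝ) / SHAdaVar.activeCount K s - 1
  let J : Finset (ℕ × Fin K × ℕ) := Finset.range (SHAdaVar.numStages K) ×ˢ
    (Finset.univ ×ˢ Finset.Ico 2 (SHAdaVar.stageBudget K n))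
  let B : Set Ω := ⋃ p ∈ J, SHAdaVar.varianceFailure τ δ n σ Y (lower p.1 p.2.2) p.1 p.2.1 p.2.2
  set S := {ω | ∀ s < SHAdaVar.numStages K, _}
  have hσmax : 0 < SHAdaVar.sigmaMax σ := by
    obtain ⟨i, hi⟩ := hσ
    exact hi.trans_le (Finset.le_sup (f := σ) (Finset.mem_univ i))
  have hcard : J.card * δ ≤ (K : ℝ) * n * δ := by
    refine mul_le_mul_of_nonneg_right ?_ hδ0.le
    have h1 : J.card = SHAdaVar.numStages K * (K * (SHAdaVar.stageBudget K n - 2)) := by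
      simp [J]
    have h2 : SHAdaVar.numStages K * SHAdaVar.stageBudget K n ≤ n := Nat.mul_div_le _ _
    have h3 : J.card ≤ K * n := by
      rw [h1]
      calc _ ≤ SHAdaVar.numStages K * (K * SHAdaVar.stageBudget K n) := by gcongr; omega
        _ = K * (SHAdaVar.numStages K * SHAdaVar.stageBudget K n) := by ring
        _ ≤ _ := by gcongr
    exact_mod_cast h3
  have hB : P.real B ≤ J.card * δ := by
    refine (measureReal_biUnion_finset_le J _).trans ?_
    rw [← nsmul_eq_mul]
    refine Finset.sum_le_card_nsmul _ _ _ fun p hp => ?_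
    simp only [J, Finset.mem_product, Finset.mem_Ico] at hp
    exact ENNReal.toReal_le_of_le_ofReal hδ0.le
      (SHAdaVar.measure_varianceFailure_le τ hδ0 hδ1 hYmeas hYlaw hYindep _ _ _ hp.2.2.1)
  have hcover : Set.univ ⊆ S ∪ B := by
    intro ω _
    by_cases hω : ω ∈ B
    · exact Or.inr hω
    refine Or.inl ?_
    have hgood : ∀ s < SHAdaVar.numStages K, ∀ t < SHAdaVar.stageBudget K n, ∀ i : Fin K, ∀ h,
        h = SHAdaVar.stageHistory τ δ s
          (SHAdaVar.activeArms τ δ n (fun s t i => Y s t i ω) s) (fun t i => Y s t i ω) t →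
        2 ≤ SHAdaVar.numPulls h i → ω ∉ SHAdaVar.varianceFailure τ δ n σ Y
          (lower s (SHAdaVar.numPulls h i)) s i (SHAdaVar.numPulls h i) := by
      intro s hs t ht i h hh h2 hmem
      refine hω (Set.mem_iUnion₂.2 ⟨(s, i, SHAdaVar.numPulls h i), ?_, hmem⟩)
      have hlen : SHAdaVar.numPulls h i ≤ t := by
        rw [← SHAdaVar.length_stageHistory τ δ s (SHAdaVar.activeArms τ δ n
          (fun s t i => Y s t i ω) s) (fun t i => Y s t i ω) t, ← hh]
        simpa [SHAdaVar.numPulls, SHAdaVar.rewards] using List.length_filter_le _ h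
      simp only [J, Finset.mem_product, Finset.mem_range, Finset.mem_univ, Finset.mem_Ico]
      exact ⟨hs, trivial, h2, hlen.trans_lt ht⟩
    intro s hs hT i hi
    refine SHAdaVar.numPulls_lower_bound τ hδ0 hδ1 s _ (fun t i => Y s t i ω) σ hσmax hT
      (fun t ht j hj h2 hlt => ?_) (fun t ht j hj h2 hle => ?_) hi
    · by_contra! hcon
      rw [SHAdaVar.card_activeArms] at hlt
      exact hgood s hs t ht j _ rfl h2 ⟨t, ht, _, rfl, rfl, Or.inl ⟨hlt, hcon⟩⟩
    · by_contra! hcon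
      rw [SHAdaVar.card_activeArms] at hle
      exact hgood s hs t ht j _ rfl h2 ⟨t, ht, _, rfl, rfl, Or.inr ⟨not_lt.2 hle, hcon⟩⟩
  have h1 : (1 : ℝ) ≤ P.real S + P.real B := by
    calc (1 : ℝ) = P.real Set.univ := by simp
      _ ≤ P.real (S ∪ B) := measureReal_mono hcover
      _ ≤ _ := measureReal_union_le _ _
  linarith
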